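/- Let $d\ge 0$ be an integer, and call a nonempty compact convex set $K\subset\mathbb R^d$ a convex body (its interior may be empty). A family of sets is \emph{pierced by $m$ points} if there are points $p_1,\dots,p_m\in\mathbb R^d$ such that every member of the family contains at least one of them. For every convex body $K\subset\mathbb R^d$ there exists a natural number $f_K(d)$ with the following property: if $n\ge 2$ and $\mathcal F_1,\dots,\mathcal F_n$ are finite families of translates of $K$ such that $A\cap B\neq\emptyset$ for all $A\in\mathcal F_i$ and $B\in\mathcal F_j$ with $i\neq j$, then there exists $j\in\{1,\dots,n\}$ such that $\bigcup_{i\neq j}\mathcal F_i$ can be pierced by $f_K(d)$ points. (The number $f_K(d)$ depends neither on $n$ nor on the families.) Moreover, in the planar case $d=2$: (a) one may choose $f_K(2)=9$ for every convex body $K\subset\mathbb R^2$; and (b) one may choose $f_K(2)=4$ for every convex body $K\subset\mathbb R^2$ of constant width, that is, such that the distance between the two supporting lines of $K$ orthogonal to $u$ is the same for all unit vectors $u\in\mathbb R^2$. -/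

import Mathlib

open scoped Pointwise

/-- A family `𝒢` of sets can be pierced by `m` points: there are points `p₁, …, pₘ`
such that every member of `𝒢` contains at least one of them. -/
def CanBePierced {E : Type*} (𝒢 : Set (Set E)) (m : ℕ) : Prop :=
  ∃ p : Fin m → E, ∀ C ∈ 𝒢, ∃ i, p i ∈ C

/-- `𝒢` is a finite family of translates `v + K` of the set `K`. -/
def IsFiniteFamilyOfTranslates {E : Type*} [AddCommGroup E] (K : Set E) (𝒢 : Set (Set E)) : Prop :=
  𝒢.Finite ∧ ∀ C ∈ 𝒢, ∃ v : E, C = v +ᵥ K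

/-- Members of two different families always intersect. -/
def CrossIntersecting {E : Type*} {n : ℕ} (F : Fin n → Set (Set E)) : Prop :=
  ∀ i j, i ≠ j → ∀ A ∈ F i, ∀ B ∈ F j, (A ∩ B).Nonempty

/-- The number `m` may be chosen as `f_K(d)`: for all `n ≥ 2` and all pairwise cross-intersecting
finite families `F₁, …, Fₙ` of translates of `K`, there is `j` such that
`⋃_{i ≠ j} Fᵢ` can be pierced by `m` points. -/
def IsDolnikovNumber {d : ℕ} (K : ConvexBody (EuclideanSpace ℝ (Fin d))) (m : ℕ) : Prop :=
  ∀ n : ℕ, 2 ≤ n → ∀ F : Fin n → Set (Set (EuclideanSpace ℝ (Fin d))),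
    (∀ i, IsFiniteFamilyOfTranslates (K : Set (EuclideanSpace ℝ (Fin d))) (F i)) →
    CrossIntersecting F →
    ∃ j : Fin n, CanBePierced (⋃ (i : Fin n) (_ : i ≠ j), F i) m

/-- The width of `K` in the direction of the unit vector `u`: the distance between the two
supporting hyperplanes of `K` orthogonal to `u`. -/
noncomputable def directionalWidth {d : ℕ} (K : ConvexBody (EuclideanSpace ℝ (Fin d)))
    (u : EuclideanSpace ℝ (Fin d)) : ℝ :=
  sSup ((fun x => inner ℝ u x) '' (K : Set (EuclideanSpace ℝ (Fin d)))) -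
    sInf ((fun x => inner ℝ u x) '' (K : Set (EuclideanSpace ℝ (Fin d))))

/-- `K` has constant (Euclidean) width. -/
def HasConstantWidth {d : ℕ} (K : ConvexBody (EuclideanSpace ℝ (Fin d))) : Prop :=
  ∃ w : ℝ, ∀ u : EuclideanSpace ℝ (Fin d), ‖u‖ = 1 → directionalWidth K u = w

/-!
Translates `v + K` and `w + K` meet exactly when `v - w ∈ K - K`, and `p` pierces `v + K`
exactly when `p - v ∈ K`. The problem is therefore to cover the translation vectors of all families
but one by few translates of `-K`, where vectors from different families differ by elements of `D = K - K`.

In any dimension one leaves out a nonempty family: the remaining vectors lie in a single translate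
of `D`, a compact set that finitely many translates of `-K` cover
(`exists_translatesPierced_sub`).

In the plane, let `D` span the plane (otherwise `K` is a segment and two points suffice). Two chords
`e` and `u` of `K` give an inscribed parallelogram with sides `e / 2` and `u / 2`.

* If all differences lie in `(3 / 2) • D`, take `e, u ∈ D` of maximal area, an Auerbach basis. Both
  coordinates with respect to it vary by at most `3 / 2`, and a `3 × 3` grid of parallelograms
  suffices (`translatesPierced_nine_of_forall_sub_mem`).
* Otherwise two vectors `v, w` of one family differ by an element outside `(3 / 2) • D`. The other
  families lie in `(v + D) ∩ (w + D)`, hence in a narrow strip, which takes four rows of two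
  parallelograms (`translatesPierced_eight_of_sub_notMem`).

If `K` has constant width `w`, then `D` lies in the disk of radius `w`, and by Jung's theorem `K`
contains a disk of radius `2 / 5 * w`, four translates of which cover any rectangle with squared
diagonal at most `64 / 25 * w ^ 2`. If no distance exceeds `w`, all vectors lie in a square with
side `w`. Otherwise a farthest pair `v, v'` at distance `δ > w` belongs to one family. The vectors of
the others lie in the lens of points within `w` of both `v` and `v'`, and have mutual distances at most
`δ`; this confines them to a rectangle as above (`translatesPierced_four_of_lens`).
-/

/-! ### Reduction to covering sets of translation vectors -/

/-- The translates `v + K` with `v ∈ B` can be pierced by at most `m` points. Equivalently, `B` is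
covered by at most `m` translates of `-K`. -/
def TranslatesPierced {E : Type*} [AddCommGroup E] (K B : Set E) (m : ℕ) : Prop :=
  ∃ P : Finset E, P.card ≤ m ∧ ∀ v ∈ B, ∃ p ∈ P, p - v ∈ K

namespace TranslatesPierced

variable {E : Type*} [AddCommGroup E] {K A B : Set E} {m k : ℕ}

theorem mono (h : TranslatesPierced K B m) (hAB : A ⊆ B) (hm : m ≤ k) :
    TranslatesPierced K A k := by
  obtain ⟨P, hP, h⟩ := h
  exact ⟨P, hP.trans hm, fun v hv => h v (hAB hv)⟩

theorem empty : TranslatesPierced K (∅ : Set E) m := ⟨∅, by simp, by simp⟩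

theorem of_sub_mem (h : TranslatesPierced K B m) (w : E) (hA : ∀ v ∈ A, v - w ∈ B) :
    TranslatesPierced K A m := by
  classical
  obtain ⟨P, hP, h⟩ := h
  refine ⟨P.image (w + ·), Finset.card_image_le.trans hP, fun v hv => ?_⟩
  obtain ⟨p, hp, hpv⟩ := h _ (hA v hv)
  refine ⟨w + p, Finset.mem_image_of_mem _ hp, ?_⟩
  convert hpv using 1
  abel

theorem of_fintype {ι : Type*} [Fintype ι] (p : ι → E) (hm : Fintype.card ι ≤ m)
    (h : ∀ v ∈ B, ∃ i, p i - v ∈ K) : TranslatesPierced K B m := by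
  classical
  refine ⟨Finset.univ.image p, Finset.card_image_le.trans hm, fun v hv => ?_⟩
  obtain ⟨i, hi⟩ := h v hv
  exact ⟨p i, Finset.mem_image_of_mem _ (Finset.mem_univ i), hi⟩

end TranslatesPierced

theorem IsFiniteFamilyOfTranslates.exists_eq_image {E : Type*} [AddCommGroup E] {K : Set E}
    {𝒢 : Set (Set E)} (h : IsFiniteFamilyOfTranslates K 𝒢) :
    ∃ V : Set E, V.Finite ∧ 𝒢 = (· +ᵥ K) '' V := by
  choose! v hv using h.2
  refine ⟨v '' 𝒢, h.1.image v, ?_⟩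
  rw [Set.image_image]
  exact (Set.image_id 𝒢).symm.trans (Set.image_congr hv)

theorem sub_mem_sub_of_vadd_inter_nonempty {E : Type*} [AddCommGroup E] {K : Set E} {v w : E}
    (h : ((v +ᵥ K) ∩ (w +ᵥ K)).Nonempty) : v - w ∈ K - K := by
  obtain ⟨x, ⟨k, hk, rfl⟩, ⟨l, hl, hkl⟩⟩ := h
  refine Set.mem_sub.2 ⟨l, hl, k, hk, ?_⟩
  simp only [vadd_eq_add] at hkl
  rw [sub_eq_sub_iff_add_eq_add, add_comm l, hkl]

theorem sub_mem_sub_comm {E : Type*} [AddCommGroup E] {K : Set E} {v w : E}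
    (h : v - w ∈ K - K) : w - v ∈ K - K := by
  obtain ⟨k, hk, l, hl, hkl⟩ := Set.mem_sub.1 h
  exact Set.mem_sub.2 ⟨l, hl, k, hk, by rw [← neg_sub k, hkl, neg_sub]⟩

/-- Passage from families of translates of `K` to finite sets of translation vectors. -/
theorem isDolnikovNumber_of_translatesPierced {d m : ℕ}
    {K : ConvexBody (EuclideanSpace ℝ (Fin d))}
    (h : ∀ (n : ℕ) [NeZero n] (V : Fin n → Set (EuclideanSpace ℝ (Fin d))), (∀ i, (V i).Finite) →
      (∀ i j, i ≠ j → ∀ v ∈ V i, ∀ w ∈ V j,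
        v - w ∈ (K : Set (EuclideanSpace ℝ (Fin d))) - (K : Set (EuclideanSpace ℝ (Fin d)))) →
      ∃ j, TranslatesPierced (K : Set (EuclideanSpace ℝ (Fin d))) (⋃ (i) (_ : i ≠ j), V i) m) :
    IsDolnikovNumber K m := by
  intro n hn F hF hcross
  have : NeZero n := ⟨by omega⟩
  choose V hV hFV using fun i => (hF i).exists_eq_image
  obtain ⟨j, P, hP, hj⟩ := h n V hV fun i j hij v hv w hw =>
    sub_mem_sub_of_vadd_inter_nonempty (hcross i j hij _ (by rw [hFV]; exact ⟨v, hv, rfl⟩) _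
      (by rw [hFV]; exact ⟨w, hw, rfl⟩))
  refine ⟨j, fun i => if hi : i.1 < P.card then P.equivFin.symm ⟨i, hi⟩ else 0, ?_⟩
  intro C hC
  simp only [Set.mem_iUnion] at hC
  obtain ⟨i, hij, hC⟩ := hC
  rw [hFV] at hC
  obtain ⟨v, hv, rfl⟩ := hC
  obtain ⟨p, hp, hpv⟩ := hj v (by simp only [Set.mem_iUnion]; exact ⟨i, hij, hv⟩)
  refine ⟨⟨P.equivFin ⟨p, hp⟩, (P.equivFin ⟨p, hp⟩).2.trans_le hP⟩, ?_⟩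
  simp only [Fin.is_lt, Fin.eta, Equiv.symm_apply_apply, dite_true]
  exact ⟨p - v, hpv, by simp⟩

/-- If `K - K` is covered by `m` translates of `-K`, then the vectors of all families but one,
lying in a single translate of `K - K`, are covered as well. -/
theorem isDolnikovNumber_of_translatesPierced_sub {d m : ℕ}
    {K : ConvexBody (EuclideanSpace ℝ (Fin d))}
    (h : TranslatesPierced (K : Set (EuclideanSpace ℝ (Fin d))) ((K : Set _) - (K : Set _)) m) :
    IsDolnikovNumber K m := by
  refine isDolnikovNumber_of_translatesPierced fun n _ V _ hV => ?_
  by_cases hne : ∃ j, (V j).Nonempty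
  · obtain ⟨j, w, hw⟩ := hne
    refine ⟨j, h.of_sub_mem w fun v hv => ?_⟩
    simp only [Set.mem_iUnion] at hv
    obtain ⟨i, hij, hv⟩ := hv
    exact hV i j hij v hv w hw
  · push Not at hne
    exact ⟨0, by simpa [hne] using TranslatesPierced.empty⟩

/-! ### Arbitrary dimension -/

theorem IsCompact.sub {E : Type*} [AddCommGroup E] [TopologicalSpace E] [IsTopologicalAddGroup E]
    {s t : Set E} (hs : IsCompact s) (ht : IsCompact t) : IsCompact (s - t) := by
  rw [sub_eq_add_neg]
  exact hs.add ht.neg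

/-- A compact convex set has nonempty interior relative to its affine span, so finitely many
translates of it cover any compact set in the direction of this span, such as `K - K`. -/
theorem exists_translatesPierced_sub {E : Type*} [NormedAddCommGroup E] [NormedSpace ℝ E]
    [FiniteDimensional ℝ E] {K : Set E} (hK : IsCompact K) (hconv : Convex ℝ K)
    (hne : K.Nonempty) : ∃ m, TranslatesPierced K (K - K) m := by
  classical
  obtain ⟨_, hmem⟩ := hne.intrinsicInterior hconv
  obtain ⟨x, hx, rfl⟩ := mem_intrinsicInterior.1 hmem
  obtain ⟨U, hUK, hU, hxU⟩ := mem_interior.1 hx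
  obtain ⟨W, hW, rfl⟩ := isOpen_induced_iff.1 hU
  have hdir : ∀ v ∈ K - K, v ∈ (affineSpan ℝ K).direction := by
    rintro _ ⟨a, ha, b, hb, rfl⟩
    exact AffineSubspace.vsub_mem_direction (subset_affineSpan ℝ K ha) (subset_affineSpan ℝ K hb)
  obtain ⟨t, ht, hcov⟩ := (hK.sub hK).elim_nhds_subcover (fun v => {y | (x : E) + v - y ∈ W})
    fun v _ => (hW.preimage (by fun_prop : Continuous fun y => (x : E) + v - y)).mem_nhds
      (by simpa using hxU)
  refine ⟨_, t.image ((x : E) + ·), le_rfl, fun v hv => ?_⟩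
  obtain ⟨p, hp, hpv⟩ := Set.mem_iUnion₂.1 (hcov hv)
  refine ⟨x + p, Finset.mem_image_of_mem _ hp, ?_⟩
  have hmem : (p - v) +ᵥ (x : E) ∈ affineSpan ℝ K :=
    AffineSubspace.vadd_mem_of_mem_direction
      (Submodule.sub_mem _ (hdir p (ht p hp)) (hdir v hv)) x.2
  have heq : (p - v) +ᵥ (x : E) = x + p - v := by rw [vadd_eq_add]; abel
  rw [heq] at hmem
  exact hUK (show (⟨x + p - v, hmem⟩ : affineSpan ℝ K) ∈ _ from hpv)

/-! ### Planar bodies: parallelograms inscribed in `K` -/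

/-- The planar cross product, that is the determinant of the matrix with columns `x` and `y`. -/
def cross (x y : EuclideanSpace ℝ (Fin 2)) : ℝ := x 0 * y 1 - x 1 * y 0

theorem cross_sub_left (x y z : EuclideanSpace ℝ (Fin 2)) :
    cross (x - y) z = cross x z - cross y z := by simp [cross]; ring

theorem cross_sub_right (x y z : EuclideanSpace ℝ (Fin 2)) :
    cross x (y - z) = cross x y - cross x z := by simp [cross]; ring

theorem cross_neg_left (x y : EuclideanSpace ℝ (Fin 2)) : cross (-x) y = -cross x y := by
  simp [cross]; ring

theorem cross_neg_right (x y : EuclideanSpace ℝ (Fin 2)) : cross x (-y) = -cross x y := by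
  simp [cross]; ring

theorem cross_smul_left (c : ℝ) (x y : EuclideanSpace ℝ (Fin 2)) :
    cross (c • x) y = c * cross x y := by simp [cross]; ring

theorem cross_smul_right (c : ℝ) (x y : EuclideanSpace ℝ (Fin 2)) :
    cross x (c • y) = c * cross x y := by simp [cross]; ring

@[fun_prop]
theorem Continuous.cross {X : Type*} [TopologicalSpace X] {f g : X → EuclideanSpace ℝ (Fin 2)}
    (hf : Continuous f) (hg : Continuous g) : Continuous fun x => _root_.cross (f x) (g x) := by
  unfold _root_.cross
  fun_prop

/-- Cramer's rule in the plane. -/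
theorem cross_smul_eq_add (u v x : EuclideanSpace ℝ (Fin 2)) :
    cross u v • x = cross x v • u + cross u x • v := by
  ext i
  fin_cases i <;> simp [cross] <;> ring

theorem eq_div_cross_smul_add {u v : EuclideanSpace ℝ (Fin 2)} (h : cross u v ≠ 0)
    (x : EuclideanSpace ℝ (Fin 2)) :
    x = (cross x v / cross u v) • u + (cross u x / cross u v) • v := by
  rw [div_eq_inv_mul, div_eq_inv_mul, mul_smul, mul_smul, ← smul_add, ← cross_smul_eq_add,
    inv_smul_smul₀ h]

theorem inner_sq_add_cross_sq (x y : EuclideanSpace ℝ (Fin 2)) :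
    inner ℝ x y ^ 2 + cross x y ^ 2 = ‖x‖ ^ 2 * ‖y‖ ^ 2 := by
  simp only [EuclideanSpace.norm_sq_eq, Fin.sum_univ_two, PiLp.inner_apply, cross,
    Real.norm_eq_abs, sq_abs, RCLike.inner_apply, conj_trivial]
  ring

/-- Expansion of `y` in the orthogonal basis formed by `x` and its rotation by a right angle. -/
theorem norm_sq_smul_eq_add (x y : EuclideanSpace ℝ (Fin 2)) :
    ‖x‖ ^ 2 • y = inner ℝ x y • x + cross x y • !₂[-x 1, x 0] := by
  ext i
  simp only [EuclideanSpace.norm_sq_eq, Fin.sum_univ_two, PiLp.inner_apply, cross,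
    Real.norm_eq_abs, sq_abs, RCLike.inner_apply, conj_trivial]
  fin_cases i <;> simp <;> ring

/-- If `e = k - l` and `u = s - t` are chords of a convex set, then the set contains a
parallelogram with sides `e / 2` and `u / 2`, spanned by the midpoints of `k, l` with `s, t`. -/
theorem Convex.exists_parallelogram_subset {E : Type*} [AddCommGroup E] [Module ℝ E] {K : Set E}
    (hK : Convex ℝ K) {e u : E} (he : e ∈ K - K) (hu : u ∈ K - K) :
    ∃ c, ∀ a b : ℝ, |a| ≤ 1 / 4 → |b| ≤ 1 / 4 → c + (a • e + b • u) ∈ K := by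
  obtain ⟨k, hk, l, hl, rfl⟩ := Set.mem_sub.1 he
  obtain ⟨s, hs, t, ht, rfl⟩ := Set.mem_sub.1 hu
  refine ⟨(1 / 4 : ℝ) • (k + l + s + t), fun a b ha hb => ?_⟩
  rw [abs_le] at ha hb
  have hsum := hK.sum_mem (t := Finset.univ) (w := ![1 / 4 + a, 1 / 4 - a, 1 / 4 + b, 1 / 4 - b])
    (z := ![k, l, s, t])
    (by intro i _; fin_cases i <;> simp <;> linarith)
    (by simp [Fin.sum_univ_four]; ring)
    (by intro i _; fin_cases i <;> simpa)
  convert hsum using 1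
  simp [Fin.sum_univ_four]
  module

/-- An interval of length `N * δ` is split into `N` intervals of length `δ`; these are described
by their midpoints. -/
theorem exists_fin_abs_sub_le {N : ℕ} (hN : 0 < N) {δ x x₀ : ℝ} (h₀ : x₀ ≤ x)
    (h₁ : x ≤ x₀ + N * δ) : ∃ i : Fin N, |x₀ + (i + 1 / 2) * δ - x| ≤ δ / 2 := by
  induction N, hN using Nat.le_induction with
  | base => exact ⟨0, by rw [abs_le]; norm_num at h₁ ⊢; constructor <;> linarith⟩
  | succ N hN ih =>
    rcases le_total x (x₀ + N * δ) with h | h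
    · obtain ⟨i, hi⟩ := ih h
      exact ⟨i.castSucc, by simpa using hi⟩
    · refine ⟨Fin.last N, ?_⟩
      push_cast at h₁
      rw [abs_le, Fin.val_last]
      constructor <;> linarith

/-- A finite set on which a function varies by at most `L` is mapped into an interval of
length `L`. -/
theorem Set.Finite.exists_le_le_add {α : Type*} {B : Set α} (hB : B.Finite) (φ : α → ℝ) {L : ℝ}
    (h : ∀ v ∈ B, ∀ w ∈ B, φ v - φ w ≤ L) : ∃ x₀, ∀ v ∈ B, x₀ ≤ φ v ∧ φ v ≤ x₀ + L := by
  rcases B.eq_empty_or_nonempty with rfl | hne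
  · exact ⟨0, by simp⟩
  · obtain ⟨w, hw, hmin⟩ := hB.exists_minimalFor φ B hne
    refine ⟨φ w, fun v hv => ⟨?_, by linarith [h v hv w hw]⟩⟩
    exact (le_total (φ w) (φ v)).elim id fun hle => hmin hv hle

/-- Covering by a grid of parallelograms inscribed in `K`, with sides `e / 2` and `u / 2`: the set
`B` is cut into `N` rows of height `1 / 2` in the direction of `u`, and the `i`-th row, which starts
at `a₀ i` and has length at most `M / 2` in the direction of `e`, is cut into `M` pieces. -/
theorem translatesPierced_of_rows {K B : Set (EuclideanSpace ℝ (Fin 2))} (hK : Convex ℝ K)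
    {e u : EuclideanSpace ℝ (Fin 2)} (he : e ∈ K - K) (hu : u ∈ K - K) (heu : cross e u ≠ 0)
    {N M : ℕ} (hN : 0 < N) (hM : 0 < M) {b₀ : ℝ} {a₀ : Fin N → ℝ}
    (hb : ∀ v ∈ B, b₀ ≤ cross e v / cross e u ∧ cross e v / cross e u ≤ b₀ + N * (1 / 2))
    (ha : ∀ v ∈ B, ∀ i : Fin N, |b₀ + (i + 1 / 2) * (1 / 2) - cross e v / cross e u| ≤ 1 / 2 / 2 →
      a₀ i ≤ cross v u / cross e u ∧ cross v u / cross e u ≤ a₀ i + M * (1 / 2)) :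
    TranslatesPierced K B (N * M) := by
  obtain ⟨c, hc⟩ := hK.exists_parallelogram_subset he hu
  refine TranslatesPierced.of_fintype (ι := Fin N × Fin M)
    (fun ij => c + ((a₀ ij.1 + (ij.2 + 1 / 2) * (1 / 2)) • e +
      (b₀ + (ij.1 + 1 / 2) * (1 / 2)) • u)) (by simp) fun v hv => ?_
  obtain ⟨i, hi⟩ := exists_fin_abs_sub_le hN (hb v hv).1 (hb v hv).2
  obtain ⟨j, hj⟩ := exists_fin_abs_sub_le hM (ha v hv i hi).1 (ha v hv i hi).2
  refine ⟨(i, j), ?_⟩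
  convert hc _ _ (hj.trans (by norm_num)) (hi.trans (by norm_num)) using 1
  nth_rw 1 [eq_div_cross_smul_add heu v]
  module

/-! ### Nine points for planar bodies -/

/-- For a segment `K` (possibly a point), `K - K` is the union of two translates of `K`. -/
theorem translatesPierced_sub_of_cross_eq_zero {K : Set (EuclideanSpace ℝ (Fin 2))}
    (hK : IsCompact K) (hconv : Convex ℝ K) (hne : K.Nonempty)
    (h : ∀ x ∈ K - K, ∀ y ∈ K - K, cross x y = 0) : TranslatesPierced K (K - K) 2 := by
  obtain ⟨e, he, hmax⟩ := (hK.sub hK).exists_isMaxOn (hne.sub hne) continuous_norm.continuousOn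
  obtain ⟨k, hk, l, hl, rfl⟩ := Set.mem_sub.1 he
  refine TranslatesPierced.of_fintype ![k, l] (by simp) fun x hx => ?_
  obtain ⟨c, hc, rfl⟩ : ∃ c : ℝ, |c| ≤ 1 ∧ x = c • (k - l) := by
    have hxe : ‖x‖ ≤ ‖k - l‖ := hmax hx
    rcases eq_or_ne (k - l) 0 with h0 | h0
    · refine ⟨0, by simp, ?_⟩
      rw [h0, norm_zero] at hxe
      simpa using norm_le_zero_iff.1 hxe
    · have hpos : 0 < ‖k - l‖ := norm_pos_iff.2 h0
      have hr : x = (inner ℝ (k - l) x / ‖k - l‖ ^ 2) • (k - l) := by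
        rw [div_eq_inv_mul, mul_smul, eq_inv_smul_iff₀ (by positivity),
          norm_sq_smul_eq_add, h _ he _ hx, zero_smul, add_zero]
      refine ⟨_, ?_, hr⟩
      rw [hr, norm_smul, Real.norm_eq_abs] at hxe
      exact le_of_mul_le_mul_right (by rwa [one_mul]) hpos
  rw [abs_le] at hc
  have hseg : ∀ a : ℝ, 0 ≤ a → a ≤ 1 → (1 - a) • k + a • l ∈ K := fun a h0 h1 =>
    hconv hk hl (by linarith) h0 (by ring)
  rcases le_total 0 c with h0 | h0
  · exact ⟨0, by convert hseg c h0 hc.2 using 1; simp; module⟩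
  · exact ⟨1, by convert hseg (1 + c) (by linarith) (by linarith) using 1; simp; module⟩

/-- If any two vectors of `B` differ by an element of `(3 / 2) • (K - K)`, then `B` is covered by
`3 * 3` translates of a parallelogram in `K` whose sides are halves of an Auerbach basis, that is,
of two chords of `K` spanning the largest possible area. -/
theorem translatesPierced_nine_of_forall_sub_mem {K B : Set (EuclideanSpace ℝ (Fin 2))}
    (hconv : Convex ℝ K) {e u : EuclideanSpace ℝ (Fin 2)} (he : e ∈ K - K) (hu : u ∈ K - K)
    (heu : 0 < cross e u) (hmax : ∀ x ∈ K - K, ∀ y ∈ K - K, cross x y ≤ cross e u) (hB : B.Finite)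
    (h : ∀ v ∈ B, ∀ w ∈ B, v - w ∈ (3 / 2 : ℝ) • (K - K)) : TranslatesPierced K B 9 := by
  obtain ⟨a₀, ha⟩ := hB.exists_le_le_add (fun v => cross v u / cross e u) (L := 3 / 2) (by
    intro v hv w hw
    obtain ⟨x, hx, hxvw⟩ := Set.mem_smul_set.1 (h v hv w hw)
    rw [div_sub_div_same, div_le_iff₀ heu, ← cross_sub_left, ← hxvw, cross_smul_left]
    linarith [hmax x hx u hu])
  obtain ⟨b₀, hb⟩ := hB.exists_le_le_add (fun v => cross e v / cross e u) (L := 3 / 2) (by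
    intro v hv w hw
    obtain ⟨x, hx, hxvw⟩ := Set.mem_smul_set.1 (h v hv w hw)
    rw [div_sub_div_same, div_le_iff₀ heu, ← cross_sub_right, ← hxvw, cross_smul_right]
    linarith [hmax e he x hx])
  refine translatesPierced_of_rows (N := 3) (M := 3) (b₀ := b₀) (a₀ := fun _ => a₀) hconv he hu
    heu.ne' (by norm_num) (by norm_num) (fun v hv => ?_) fun v hv _ _ => ?_
  · convert hb v hv using 3; norm_num
  · convert ha v hv using 3; norm_num

theorem neg_mem_sub_self {E : Type*} [AddCommGroup E] {K : Set E} {x : E} (hx : x ∈ K - K) :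
    -x ∈ K - K := by
  simpa using sub_mem_sub_comm (v := x) (w := 0) (by simpa using hx)

/-- If `v - w` lies outside `(3 / 2) • (K - K)`, then `(v + (K - K)) ∩ (w + (K - K))` is covered by
`4 * 2` translates of `-K`. It lies in a strip whose width is a quarter of that of `K - K` in the
same direction; rows transversal to the strip are used, parallel to a chord `e` of `K` that joins
the supporting lines of `K` parallel to the strip. -/
theorem translatesPierced_eight_of_sub_notMem {K B : Set (EuclideanSpace ℝ (Fin 2))}
    (hK : IsCompact K) (hconv : Convex ℝ K) (hne : K.Nonempty)
    (hnd : ∃ x ∈ K - K, ∃ y ∈ K - K, cross x y ≠ 0) {v w : EuclideanSpace ℝ (Fin 2)}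
    (hvw : v - w ∉ (3 / 2 : ℝ) • (K - K)) (hBv : ∀ b ∈ B, b - v ∈ K - K)
    (hBw : ∀ b ∈ B, b - w ∈ K - K) : TranslatesPierced K B 8 := by
  have hD : IsCompact (K - K) := hK.sub hK
  obtain ⟨f, s, hfs, hsf⟩ := geometric_hahn_banach_closed_point
    ((hconv.sub hconv).smul (3 / 2 : ℝ)) (hD.smul (3 / 2 : ℝ)).isClosed hvw
  obtain ⟨e, he, hemax⟩ := hD.exists_isMaxOn (hne.sub hne) f.continuous.continuousOn
  replace hemax : ∀ x ∈ K - K, f x ≤ f e := hemax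
  have hfe_lt : 3 / 2 * f e < f (v - w) := by
    have := hfs _ (Set.smul_mem_smul_set he)
    rw [map_smul, smul_eq_mul] at this
    exact this.trans hsf
  obtain ⟨u, hu, humax⟩ := hD.exists_isMaxOn (hne.sub hne)
    (by fun_prop : Continuous fun x => cross e x).continuousOn
  replace humax : ∀ x ∈ K - K, cross e x ≤ cross e u := humax
  obtain ⟨x, hx, y, hy, hxy⟩ := hnd
  -- A functional that vanishes on `K - K` vanishes on its span, which is the whole plane.
  have hfe : 0 < f e := by
    by_contra! hle
    have h0 : ∀ z ∈ K - K, f z = 0 := fun z hz => by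
      have h1 := hemax z hz
      have h2 := hemax _ (neg_mem_sub_self hz)
      rw [map_neg] at h2
      linarith
    have : f (v - w) = 0 := by
      rw [eq_div_cross_smul_add hxy (v - w)]
      simp [h0 x hx, h0 y hy]
    rw [this, h0 e he] at hfe_lt
    linarith
  have heu : 0 < cross e u := by
    by_contra! hle
    have h0 : ∀ z ∈ K - K, cross e z = 0 := fun z hz => by
      have h1 := humax z hz
      have h2 := humax _ (neg_mem_sub_self hz)
      rw [cross_neg_right] at h2
      linarith
    have h1 := cross_smul_eq_add x y e
    have h2 : cross x e = 0 := by
      have := h0 x hx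
      unfold cross at this ⊢
      linarith
    rw [h0 y hy, h2, zero_smul, zero_smul, add_zero, smul_eq_zero_iff_right hxy] at h1
    rw [h1, map_zero] at hfe
    exact hfe.false
  set α := fun b => cross b u / cross e u with hα
  set β := fun b => cross e b / cross e u with hβ
  set σ := f u / f e with hσ
  have hσ1 : σ ≤ 1 := (div_le_one hfe).2 (hemax u hu)
  have hσ2 : -1 ≤ σ := by
    rw [hσ, le_div_iff₀ hfe]
    have := hemax _ (neg_mem_sub_self hu)
    rw [map_neg] at this
    linarith
  have hf : ∀ b, f b / f e = α b + σ * β b := fun b => by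
    conv_lhs => rw [eq_div_cross_smul_add heu.ne' b]
    rw [map_add, map_smul, map_smul, smul_eq_mul, smul_eq_mul]
    simp only [hα, hβ, hσ]
    field_simp
  have hfB : ∀ b ∈ B, f v / f e - 1 ≤ f b / f e ∧ f b / f e ≤ f v / f e - 1 + 1 / 2 := by
    intro b hb
    have h1 := hemax _ (neg_mem_sub_self (hBv b hb))
    have h2 := hemax _ (hBw b hb)
    rw [map_neg, map_sub] at h1
    rw [map_sub] at h2 hfe_lt
    rw [← sub_nonneg, ← sub_nonneg (b := f b / f e)]
    have h3 : f b / f e - (f v / f e - 1) = (f b - f v + f e) / f e := by field_simp; ring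
    have h4 : f v / f e - 1 + 1 / 2 - f b / f e = (f v - 1 / 2 * f e - f b) / f e := by
      field_simp; ring
    rw [h3, h4]
    exact ⟨div_nonneg (by linarith) hfe.le, div_nonneg (by linarith) hfe.le⟩
  refine translatesPierced_of_rows (N := 4) (M := 2) (b₀ := β v - 1)
    (a₀ := fun i => f v / f e - 1 - σ * (β v - 1 + (i + 1 / 2) * (1 / 2)) - |σ| / 4) hconv he hu
    heu.ne' (by norm_num) (by norm_num) (fun b hb => ?_) fun b hb i hi => ?_
  · have h1 := humax _ (hBv b hb)
    have h2 := humax _ (neg_mem_sub_self (hBv b hb))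
    rw [cross_neg_right, cross_sub_right] at h2
    rw [cross_sub_right] at h1
    have h3 : β b - β v = (cross e b - cross e v) / cross e u := by rw [hβ]; ring
    have h4 : β b - β v ≤ 1 := by rw [h3, div_le_one heu]; linarith
    have h5 : -1 ≤ β b - β v := by rw [h3, le_div_iff₀ heu]; linarith
    constructor
    · linarith
    · push_cast
      linarith
  · -- Within a row `σ * β` deviates from its value on the midline by at most `|σ| / 4`.
    have hdev : |σ * ((β v - 1 + (i + 1 / 2) * (1 / 2)) - β b)| ≤ |σ| / 4 := by
      rw [abs_mul]
      have := mul_le_mul_of_nonneg_left hi (abs_nonneg σ)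
      linarith
    have hσabs : |σ| ≤ 1 := abs_le.2 ⟨hσ2, hσ1⟩
    rw [abs_le, mul_sub] at hdev
    obtain ⟨h1, h2⟩ := hfB b hb
    rw [hf b] at h1 h2
    constructor
    · linarith
    · push_cast
      linarith

theorem isDolnikovNumber_nine (K : ConvexBody (EuclideanSpace ℝ (Fin 2))) :
    IsDolnikovNumber K 9 := by
  have hK := K.isCompact
  have hconv := K.convex
  have hne := K.nonempty
  set D := (K : Set (EuclideanSpace ℝ (Fin 2))) - (K : Set (EuclideanSpace ℝ (Fin 2))) with hD
  have hDc : IsCompact D := hK.sub hK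
  have hDne : D.Nonempty := hne.sub hne
  by_cases hnd : ∀ x ∈ D, ∀ y ∈ D, cross x y = 0
  · exact isDolnikovNumber_of_translatesPierced_sub
      ((translatesPierced_sub_of_cross_eq_zero hK hconv hne hnd).mono le_rfl (by norm_num))
  push Not at hnd
  refine isDolnikovNumber_of_translatesPierced fun n _ V hfin hV => ?_
  by_cases hfar : ∃ j, ∃ v ∈ V j, ∃ w ∈ V j, v - w ∉ (3 / 2 : ℝ) • D
  · obtain ⟨j, v, hv, w, hw, hvw⟩ := hfar
    have hmem : ∀ z ∈ V j, ∀ b ∈ ⋃ (i) (_ : i ≠ j), V i, b - z ∈ D := fun z hz b hb => by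
      simp only [Set.mem_iUnion] at hb
      obtain ⟨i, hij, hb⟩ := hb
      exact hV i j hij b hb z hz
    exact ⟨j, (translatesPierced_eight_of_sub_notMem hK hconv hne hnd hvw (hmem v hv)
      (hmem w hw)).mono le_rfl (by norm_num)⟩
  · push Not at hfar
    obtain ⟨⟨e, u⟩, ⟨he, hu⟩, hmax⟩ := (hDc.prod hDc).exists_isMaxOn (hDne.prod hDne)
      (by fun_prop : Continuous fun p : EuclideanSpace ℝ (Fin 2) × EuclideanSpace ℝ (Fin 2) =>
        cross p.1 p.2).continuousOn
    replace hmax : ∀ x ∈ D, ∀ y ∈ D, cross x y ≤ cross e u :=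
      fun x hx y hy => hmax (Set.mk_mem_prod hx hy)
    have heu : 0 < cross e u := by
      obtain ⟨x, hx, y, hy, hxy⟩ := hnd
      rcases hxy.lt_or_gt with hlt | hgt
      · have := hmax _ (neg_mem_sub_self hx) y hy
        rw [cross_neg_left] at this
        linarith
      · exact hgt.trans_le (hmax x hx y hy)
    refine ⟨0, translatesPierced_nine_of_forall_sub_mem hconv he hu heu hmax
      (Set.finite_iUnion fun i => Set.finite_iUnion fun _ => hfin i) fun v hv w hw => ?_⟩
    simp only [Set.mem_iUnion] at hv hw
    obtain ⟨i, -, hv⟩ := hv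
    obtain ⟨j, -, hw⟩ := hw
    rcases eq_or_ne i j with rfl | hij
    · exact hfar i v hv w hw
    · have h0 : (0 : EuclideanSpace ℝ (Fin 2)) ∈ D := by
        obtain ⟨k, hk⟩ := hne
        exact Set.mem_sub.2 ⟨k, hk, k, hk, sub_self k⟩
      refine Set.mem_smul_set.2 ⟨(2 / 3 : ℝ) • (v - w), ?_, by rw [smul_smul]; norm_num⟩
      exact (hconv.sub hconv).smul_mem_of_zero_mem h0 (hV i j hij v hv w hw)
        ⟨by norm_num, by norm_num⟩

/-! ### Jung's theorem -/

/-- **Jung's theorem** for finitely many points in a real inner product space. The centre is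
`∑ i, l i • p i` where the weights `l` maximize `∑ i, l i * ‖p i‖ ^ 2 - ‖∑ i, l i • p i‖ ^ 2`, which
is the variance of the weighted points. Moving the weight towards one point `p i` cannot increase
the variance, so it bounds the squared distance from `p i` to the centre. -/
theorem exists_forall_norm_sub_sq_le {E ι : Type*} [NormedAddCommGroup E] [InnerProductSpace ℝ E]
    [Fintype ι] [Nonempty ι] (p : ι → E) {D : ℝ} (hD : ∀ i j, ‖p i - p j‖ ^ 2 ≤ D) :
    ∃ c, ∀ i, ‖p i - c‖ ^ 2 ≤ D / 2 * (1 - 1 / Fintype.card ι) := by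
  classical
  set φ : (ι → ℝ) → ℝ := fun l => ∑ i, l i * ‖p i‖ ^ 2 - ‖∑ i, l i • p i‖ ^ 2 with hφ
  obtain ⟨l, hl, hmax⟩ := (isCompact_stdSimplex ℝ ι).exists_isMaxOn
    ⟨_, single_mem_stdSimplex ℝ (Classical.arbitrary ι)⟩
    (by fun_prop : Continuous φ).continuousOn
  have hl1 : ∑ i, l i = 1 := hl.2
  set c := ∑ i, l i • p i with hc
  have hvar : φ l ≤ D / 2 * (1 - 1 / Fintype.card ι) := by
    have hpair : ∑ i, ∑ j, l i * l j * ‖p i - p j‖ ^ 2 = 2 * φ l := by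
      have hcc : ‖c‖ ^ 2 = ∑ i, ∑ j, l i * l j * inner ℝ (p i) (p j) := by
        rw [← real_inner_self_eq_norm_sq, hc, sum_inner]
        refine Finset.sum_congr rfl fun i _ => ?_
        rw [inner_sum]
        refine Finset.sum_congr rfl fun j _ => ?_
        rw [real_inner_smul_left, real_inner_smul_right]
        ring
      have h1 : ∑ i, ∑ j, l i * l j * ‖p i‖ ^ 2 = ∑ i, l i * ‖p i‖ ^ 2 := by
        refine Finset.sum_congr rfl fun i _ => ?_
        rw [← Finset.sum_mul, ← Finset.mul_sum, hl1, mul_one]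
      have h2 : ∑ i, ∑ j, l i * l j * ‖p j‖ ^ 2 = ∑ i, l i * ‖p i‖ ^ 2 := by
        rw [Finset.sum_comm, ← h1]
        simp only [mul_comm (l _) (l _)]
      have h3 : ∀ i j, l i * l j * ‖p i - p j‖ ^ 2 = l i * l j * ‖p i‖ ^ 2 -
          2 * (l i * l j * inner ℝ (p i) (p j)) + l i * l j * ‖p j‖ ^ 2 := fun i j => by
        rw [norm_sub_sq_real]
        ring
      simp only [h3, Finset.sum_add_distrib, Finset.sum_sub_distrib, ← Finset.mul_sum]
      rw [h1, h2, ← hcc, hφ]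
      ring
    have hle : ∑ i, ∑ j, l i * l j * ‖p i - p j‖ ^ 2 ≤ D * (1 - ∑ i, l i ^ 2) := by
      have hone : ∑ i, ∑ j, l i * l j = 1 := by
        rw [← Finset.sum_mul_sum, hl1, one_mul]
      have hdiag : ∑ i, l i ^ 2 = ∑ i, ∑ j, if i = j then l i * l j else 0 := by
        refine Finset.sum_congr rfl fun i _ => ?_
        rw [Finset.sum_ite_eq Finset.univ i]
        simp [sq]
      rw [← hone, hdiag, ← Finset.sum_sub_distrib, Finset.mul_sum]
      refine Finset.sum_le_sum fun i _ => ?_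
      rw [← Finset.sum_sub_distrib, Finset.mul_sum]
      refine Finset.sum_le_sum fun j _ => ?_
      split_ifs with hij
      · simp [hij]
      · rw [sub_zero, mul_comm D]
        exact mul_le_mul_of_nonneg_left (hD i j) (mul_nonneg (hl.1 i) (hl.1 j))
    have hD0 : 0 ≤ D := (sq_nonneg _).trans (hD (Classical.arbitrary ι) (Classical.arbitrary ι))
    have hcs : 1 / (Fintype.card ι : ℝ) ≤ ∑ i, l i ^ 2 := by
      have := sq_sum_le_card_mul_sum_sq (s := Finset.univ) (f := l)
      rw [hl1, one_pow, Finset.card_univ] at this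
      rw [div_le_iff₀ (by exact_mod_cast Fintype.card_pos)]
      linarith
    have := mul_le_mul_of_nonneg_left hcs hD0
    linarith
  refine ⟨c, fun i => le_trans ?_ hvar⟩
  have hstep : ∀ t : ℝ, 0 < t → t ≤ 1 → ‖p i - c‖ ^ 2 - φ l ≤ t * ‖p i - c‖ ^ 2 := by
    intro t h0 h1
    have hmem := (convex_stdSimplex ℝ ι) hl (single_mem_stdSimplex ℝ i)
      (by linarith : 0 ≤ 1 - t) h0.le (by ring)
    have hle : φ _ ≤ φ l := hmax hmem
    have hφt : φ ((1 - t) • l + t • Pi.single i 1) =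
        (1 - t) * ∑ j, l j * ‖p j‖ ^ 2 + t * ‖p i‖ ^ 2 - ‖(1 - t) • c + t • p i‖ ^ 2 := by
      simp only [hφ, Pi.add_apply, Pi.smul_apply, smul_eq_mul, add_mul, add_smul,
        Finset.sum_add_distrib, mul_assoc, ← Finset.mul_sum, mul_smul, ← Finset.smul_sum]
      simp [Pi.single_apply, hc]
    rw [hφt, norm_add_sq_real, norm_smul, norm_smul, mul_pow, mul_pow, real_inner_smul_left,
      real_inner_smul_right, Real.norm_eq_abs, Real.norm_eq_abs, sq_abs, sq_abs] at hle
    have hφl : φ l = ∑ j, l j * ‖p j‖ ^ 2 - ‖c‖ ^ 2 := rfl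
    have hpc := norm_sub_sq_real (p i) c
    rw [real_inner_comm] at hpc
    refine le_of_mul_le_mul_left ?_ h0
    rw [hpc]
    nlinarith
  have hφ0 : 0 ≤ φ l := by
    have := hstep 1 one_pos le_rfl
    linarith
  by_contra! hlt
  have hX : 0 < ‖p i - c‖ ^ 2 := hφ0.trans_lt hlt
  have := hstep ((‖p i - c‖ ^ 2 - φ l) / (2 * ‖p i - c‖ ^ 2)) (by apply div_pos <;> linarith)
    ((div_le_one (by linarith)).2 (by linarith))
  rw [div_mul_eq_mul_div, mul_div_mul_right _ _ hX.ne'] at this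
  linarith

/-- **Jung's theorem**: a set of diameter `w` in the plane lies in a disk of radius `w / √3`. By
Helly's theorem it suffices to consider at most three points. -/
theorem exists_subset_closedBall_of_dist_le {s : Set (EuclideanSpace ℝ (Fin 2))} {w R : ℝ}
    (hR : 0 ≤ R) (hwR : w ^ 2 ≤ 3 * R ^ 2) (hs : ∀ x ∈ s, ∀ y ∈ s, dist x y ≤ w) :
    ∃ c, s ⊆ Metric.closedBall c R := by
  have hne : (⋂ x : s, Metric.closedBall (x : EuclideanSpace ℝ (Fin 2)) R).Nonempty := by
    refine Convex.helly_theorem_compact' (𝕜 := ℝ) (fun x => convex_closedBall _ _)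
      (fun x => isCompact_closedBall _ _) fun I hI => ?_
    rw [finrank_euclideanSpace_fin] at hI
    rcases I.eq_empty_or_nonempty with rfl | hIne
    · exact ⟨0, by simp⟩
    have := hIne.coe_sort
    obtain ⟨c, hc⟩ := exists_forall_norm_sub_sq_le
      (fun i : I => ((i : s) : EuclideanSpace ℝ (Fin 2))) (D := w ^ 2) fun i j => by
        rw [← dist_eq_norm]
        exact pow_le_pow_left₀ dist_nonneg (hs _ i.1.2 _ j.1.2) 2
    refine ⟨c, Set.mem_iInter₂.2 fun x hx => ?_⟩
    rw [Metric.mem_closedBall, dist_comm, dist_eq_norm]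
    refine le_of_sq_le_sq ((hc ⟨x, hx⟩).trans ?_) hR
    have hcard : (1 : ℝ) / 3 ≤ 1 / Fintype.card I := by
      rw [Fintype.card_coe]
      exact one_div_le_one_div_of_le (by exact_mod_cast hIne.card_pos) (by exact_mod_cast hI)
    have := mul_le_mul_of_nonneg_left hcard (sq_nonneg w)
    linarith
  obtain ⟨c, hc⟩ := hne
  refine ⟨c, fun x hx => ?_⟩
  rw [Metric.mem_closedBall, dist_comm]
  exact Set.mem_iInter.1 hc ⟨x, hx⟩

/-! ### Bodies of constant width -/

/-- Two points `k` and `l` of a body of constant width `w` are at distance at most `w`, which is the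
width in the direction of `k - l`. -/
theorem dist_le_of_directionalWidth_eq {d : ℕ} {K : ConvexBody (EuclideanSpace ℝ (Fin d))} {w : ℝ}
    (hw : ∀ u : EuclideanSpace ℝ (Fin d), ‖u‖ = 1 → directionalWidth K u = w) (hw0 : 0 ≤ w)
    {k l : EuclideanSpace ℝ (Fin d)} (hk : k ∈ K) (hl : l ∈ K) : dist k l ≤ w := by
  rcases eq_or_ne k l with rfl | hne
  · simpa using hw0
  have h0 : ‖k - l‖ ≠ 0 := norm_ne_zero_iff.2 (sub_ne_zero.2 hne)
  have hu : ‖(‖k - l‖⁻¹ • (k - l) : EuclideanSpace ℝ (Fin d))‖ = 1 := by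
    rw [norm_smul, norm_inv, norm_norm, inv_mul_cancel₀ h0]
  have hc : IsCompact ((fun x => inner ℝ (‖k - l‖⁻¹ • (k - l)) x) '' (K : Set _)) :=
    K.isCompact.image (by fun_prop)
  have h1 := le_csSup hc.bddAbove (Set.mem_image_of_mem _ hk)
  have h2 := csInf_le hc.bddBelow (Set.mem_image_of_mem _ hl)
  have h3 : inner ℝ (‖k - l‖⁻¹ • (k - l)) k - inner ℝ (‖k - l‖⁻¹ • (k - l)) l = dist k l := by
    rw [← inner_sub_right, real_inner_smul_left, real_inner_self_eq_norm_sq, dist_eq_norm]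
    field_simp
  have h4 := hw _ hu
  unfold directionalWidth at h4
  linarith

theorem directionalWidth_nonneg {d : ℕ} (K : ConvexBody (EuclideanSpace ℝ (Fin d)))
    (u : EuclideanSpace ℝ (Fin d)) : 0 ≤ directionalWidth K u := by
  have hc : IsCompact ((fun x => inner ℝ u x) '' (K : Set (EuclideanSpace ℝ (Fin d)))) :=
    K.isCompact.image (by fun_prop)
  exact sub_nonneg.2 (csInf_le_csSup (K.nonempty.image _) hc.bddBelow hc.bddAbove)

/-- A body of constant width `w` in a disk of radius `R` contains the concentric disk of radius
`w - R`: its support function in direction `u` is `w` minus the one in direction `-u`. -/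
theorem closedBall_sub_subset_of_directionalWidth_eq {d : ℕ}
    {K : ConvexBody (EuclideanSpace ℝ (Fin d))} {w R : ℝ}
    (hw : ∀ u : EuclideanSpace ℝ (Fin d), ‖u‖ = 1 → directionalWidth K u = w)
    {c : EuclideanSpace ℝ (Fin d)} (hc : (K : Set _) ⊆ Metric.closedBall c R) :
    Metric.closedBall c (w - R) ⊆ (K : Set (EuclideanSpace ℝ (Fin d))) := by
  intro x hx
  by_contra hxK
  obtain ⟨f, s, hfs, hsf⟩ := geometric_hahn_banach_closed_point K.convex K.isClosed hxK
  obtain ⟨y, rfl⟩ := (InnerProductSpace.toDual ℝ _).surjective f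
  simp only [InnerProductSpace.toDual_apply_apply] at hfs hsf
  have hy : y ≠ 0 := by
    rintro rfl
    obtain ⟨k, hk⟩ := K.nonempty
    have := hfs k hk
    simp only [inner_zero_left] at this hsf
    linarith
  have hy0 : 0 < ‖y‖ := norm_pos_iff.2 hy
  set u := ‖y‖⁻¹ • y with hu
  have hu1 : ‖u‖ = 1 := by rw [hu, norm_smul, norm_inv, norm_norm, inv_mul_cancel₀ hy0.ne']
  have hinner : ∀ z, inner ℝ u z = ‖y‖⁻¹ * inner ℝ y z := fun z => real_inner_smul_left _ _ _
  have hsup : sSup ((fun z => inner ℝ u z) '' (K : Set _)) < inner ℝ u x := by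
    have : sSup ((fun z => inner ℝ u z) '' (K : Set _)) ≤ ‖y‖⁻¹ * s := by
      refine csSup_le (K.nonempty.image _) ?_
      rintro _ ⟨k, hk, rfl⟩
      simp only [hinner]
      exact mul_le_mul_of_nonneg_left (hfs k hk).le (by positivity)
    rw [hinner]
    exact this.trans_lt (mul_lt_mul_of_pos_left hsf (by positivity))
  have hinf : inner ℝ u c - R ≤ sInf ((fun z => inner ℝ u z) '' (K : Set _)) := by
    refine le_csInf (K.nonempty.image _) ?_
    rintro _ ⟨k, hk, rfl⟩
    have h1 := real_inner_le_norm u (c - k)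
    have h2 := hc hk
    rw [Metric.mem_closedBall, dist_comm, dist_eq_norm] at h2
    rw [hu1, one_mul, inner_sub_right] at h1
    simp only
    linarith
  have h1 := real_inner_le_norm u (x - c)
  rw [Metric.mem_closedBall, dist_eq_norm] at hx
  rw [hu1, one_mul, inner_sub_right] at h1
  have h2 := hw u hu1
  unfold directionalWidth at h2
  linarith

/-- A rectangle with sides `L` and `H` is cut into four quarters, each contained in a disk of
radius `r` as soon as its diagonal is at most `2 * r`. -/
theorem translatesPierced_four_of_rectangle {K B : Set (EuclideanSpace ℝ (Fin 2))}
    {c e : EuclideanSpace ℝ (Fin 2)} {r x₀ y₀ L H : ℝ} (hr : 0 ≤ r)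
    (hK : Metric.closedBall c r ⊆ K) (he : ‖e‖ = 1) (hLH : L ^ 2 + H ^ 2 ≤ 16 * r ^ 2)
    (hL : ∀ v ∈ B, x₀ ≤ inner ℝ e v ∧ inner ℝ e v ≤ x₀ + L)
    (hH : ∀ v ∈ B, y₀ ≤ cross e v ∧ cross e v ≤ y₀ + H) : TranslatesPierced K B 4 := by
  refine TranslatesPierced.of_fintype (ι := Fin 2 × Fin 2)
    (fun ij => c + ((x₀ + (ij.1 + 1 / 2) * (L / 2)) • e +
      (y₀ + (ij.2 + 1 / 2) * (H / 2)) • !₂[-e 1, e 0])) (by simp) fun v hv => ?_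
  obtain ⟨hx₀, hx₁⟩ := hL v hv
  obtain ⟨hy₀, hy₁⟩ := hH v hv
  obtain ⟨i, hi⟩ := exists_fin_abs_sub_le (N := 2) (δ := L / 2) two_pos hx₀
    (by push_cast; linarith)
  obtain ⟨j, hj⟩ := exists_fin_abs_sub_le (N := 2) (δ := H / 2) two_pos hy₀
    (by push_cast; linarith)
  refine ⟨(i, j), hK ?_⟩
  set a := x₀ + (i + 1 / 2) * (L / 2)
  set b := y₀ + (j + 1 / 2) * (H / 2)
  have hv' := norm_sq_smul_eq_add e v
  rw [he, one_pow, one_smul] at hv'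
  have he2 : e 0 ^ 2 + e 1 ^ 2 = 1 := by
    have := EuclideanSpace.norm_sq_eq e
    rw [he] at this
    simpa [Fin.sum_univ_two] using this.symm
  have hsub : c + (a • e + b • !₂[-e 1, e 0]) - v - c =
      (a - inner ℝ e v) • e + (b - cross e v) • !₂[-e 1, e 0] := by
    nth_rw 1 [hv']
    module
  have hnorm : ‖(a - inner ℝ e v) • e + (b - cross e v) • !₂[-e 1, e 0]‖ ^ 2 =
      (a - inner ℝ e v) ^ 2 + (b - cross e v) ^ 2 := by
    rw [EuclideanSpace.norm_sq_eq, Fin.sum_univ_two]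
    simp only [PiLp.add_apply, PiLp.smul_apply, smul_eq_mul, Real.norm_eq_abs, sq_abs]
    simp
    linear_combination ((a - inner ℝ e v) ^ 2 + (b - cross e v) ^ 2) * he2
  rw [Metric.mem_closedBall, dist_eq_norm, hsub]
  refine le_of_sq_le_sq ?_ hr
  rw [hnorm]
  have h1 := sq_le_sq' (by linarith [(abs_le.1 hi).1]) (abs_le.1 hi).2
  have h2 := sq_le_sq' (by linarith [(abs_le.1 hj).1]) (abs_le.1 hj).2
  linarith

/-- If `v` and `v'` are at distance `δ > w`, then the points at distance at most `w` from both form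
a lens of width `2 * w - δ` and height `√(4 * w ^ 2 - δ ^ 2)`. A part `B` of it in which all
distances are at most `δ` fits into a rectangle with squared diagonal at most `5 / 2 * w ^ 2`: its height is
bounded by `δ` if `δ ≤ 3 / 2 * w`, and by the height of the lens otherwise. -/
theorem translatesPierced_four_of_lens {K B : Set (EuclideanSpace ℝ (Fin 2))}
    {c v v' : EuclideanSpace ℝ (Fin 2)} {w : ℝ} (hw : 0 ≤ w)
    (hK : Metric.closedBall c (2 / 5 * w) ⊆ K) (hB : B.Finite) (hvv : w < dist v v')
    (hBv : ∀ b ∈ B, dist b v ≤ w) (hBv' : ∀ b ∈ B, dist b v' ≤ w)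
    (hBB : ∀ a ∈ B, ∀ b ∈ B, dist a b ≤ dist v v') : TranslatesPierced K B 4 := by
  rcases B.eq_empty_or_nonempty with rfl | ⟨b₀, hb₀⟩
  · exact TranslatesPierced.empty
  set δ := dist v v' with hδ
  have hδ0 : 0 < δ := hw.trans_lt hvv
  have hδ2 : δ ≤ 2 * w := by
    have := dist_triangle_left v v' b₀
    linarith [hBv b₀ hb₀, hBv' b₀ hb₀]
  set e := δ⁻¹ • (v - v') with he
  have hve : v - v' = δ • e := by rw [he, smul_inv_smul₀ hδ0.ne']
  have he1 : ‖e‖ = 1 := by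
    rw [he, norm_smul, norm_inv, ← dist_eq_norm, ← hδ, Real.norm_of_nonneg hδ0.le,
      inv_mul_cancel₀ hδ0.ne']
  have hcoord : ∀ x, inner ℝ e x ^ 2 + cross e x ^ 2 = ‖x‖ ^ 2 := fun x => by
    rw [inner_sq_add_cross_sq, he1]
    ring
  have hin : ∀ x, |inner ℝ e x| ≤ ‖x‖ := fun x =>
    abs_le_of_sq_le_sq (by nlinarith [hcoord x, sq_nonneg (cross e x)]) (norm_nonneg x)
  have hcr : ∀ x, |cross e x| ≤ ‖x‖ := fun x =>
    abs_le_of_sq_le_sq (by nlinarith [hcoord x, sq_nonneg (inner ℝ e x)]) (norm_nonneg x)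
  have hev : inner ℝ e v = inner ℝ e v' + δ := by
    have : inner ℝ e (v - v') = δ := by
      rw [hve, real_inner_smul_right, real_inner_self_eq_norm_sq, he1]
      ring
    rw [inner_sub_right] at this
    linarith
  have hcv : cross e v = cross e v' := by
    have : cross e (v - v') = 0 := by
      rw [hve, cross_smul_right]
      unfold cross
      ring
    rw [cross_sub_right] at this
    linarith
  have hL : ∀ b ∈ B, inner ℝ e v - w ≤ inner ℝ e b ∧
      inner ℝ e b ≤ inner ℝ e v - w + (2 * w - δ) := by
    intro b hb
    have h1 := (abs_le.1 (hin (b - v))).1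
    have h2 := (abs_le.1 (hin (b - v'))).2
    rw [← dist_eq_norm, inner_sub_right] at h1 h2
    constructor <;> linarith [hBv b hb, hBv' b hb]
  rcases le_total δ (3 / 2 * w) with hle | hge
  · obtain ⟨y₀, hy⟩ := hB.exists_le_le_add (fun b => cross e b) (L := δ) fun a ha b hb => by
      rw [← cross_sub_right]
      exact (le_abs_self _).trans ((hcr _).trans (by rw [← dist_eq_norm]; exact hBB a ha b hb))
    refine translatesPierced_four_of_rectangle (by positivity) hK he1 ?_ hL hy
    nlinarith
  · -- The parallelogram law shows that `4 * (cross e (b - v)) ^ 2 ≤ 4 * w ^ 2 - δ ^ 2`.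
    have hcross : ∀ b ∈ B, |cross e b - cross e v| ≤ √(4 * w ^ 2 - δ ^ 2) / 2 := by
      intro b hb
      have h1 := hcoord (b - v)
      have h2 := hcoord (b - v')
      have h3 := pow_le_pow_left₀ dist_nonneg (hBv b hb) 2
      have h4 := pow_le_pow_left₀ dist_nonneg (hBv' b hb) 2
      rw [dist_eq_norm] at h3 h4
      rw [inner_sub_right, cross_sub_right] at h1 h2
      rw [hev] at h1
      rw [← hcv] at h2
      rw [le_div_iff₀ two_pos]
      refine Real.le_sqrt_of_sq_le ?_
      rw [mul_pow, sq_abs]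
      nlinarith [sq_nonneg (2 * (inner ℝ e b - inner ℝ e v') - δ)]
    refine translatesPierced_four_of_rectangle (y₀ := cross e v - √(4 * w ^ 2 - δ ^ 2) / 2)
      (H := √(4 * w ^ 2 - δ ^ 2)) (by positivity) hK he1 ?_ hL fun b hb => ?_
    · rw [Real.sq_sqrt (by nlinarith)]
      nlinarith
    · have := abs_le.1 (hcross b hb)
      constructor <;> linarith

/-- A set in which all distances are at most `w` lies in a square with side `w`. -/
theorem translatesPierced_four_of_forall_dist_le {K B : Set (EuclideanSpace ℝ (Fin 2))}
    {c : EuclideanSpace ℝ (Fin 2)} {w : ℝ} (hw : 0 ≤ w)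
    (hK : Metric.closedBall c (2 / 5 * w) ⊆ K) (hB : B.Finite)
    (hBB : ∀ a ∈ B, ∀ b ∈ B, dist a b ≤ w) : TranslatesPierced K B 4 := by
  set e : EuclideanSpace ℝ (Fin 2) := EuclideanSpace.single 0 1 with he
  have he1 : ‖e‖ = 1 := by simp [he]
  have hcoord : ∀ x, inner ℝ e x ^ 2 + cross e x ^ 2 = ‖x‖ ^ 2 := fun x => by
    rw [inner_sq_add_cross_sq, he1]
    ring
  obtain ⟨x₀, hx⟩ := hB.exists_le_le_add (fun b => inner ℝ e b) (L := w) fun a ha b hb => by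
    rw [← inner_sub_right]
    refine (le_of_sq_le_sq ?_ (norm_nonneg _)).trans
      ((dist_eq_norm a b).symm.trans_le (hBB a ha b hb))
    linarith [hcoord (a - b), sq_nonneg (cross e (a - b))]
  obtain ⟨y₀, hy⟩ := hB.exists_le_le_add (fun b => cross e b) (L := w) fun a ha b hb => by
    rw [← cross_sub_right]
    refine (le_of_sq_le_sq ?_ (norm_nonneg _)).trans
      ((dist_eq_norm a b).symm.trans_le (hBB a ha b hb))
    linarith [hcoord (a - b), sq_nonneg (inner ℝ e (a - b))]
  refine translatesPierced_four_of_rectangle (by positivity) hK he1 ?_ hx hy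
  nlinarith

theorem isDolnikovNumber_four {K : ConvexBody (EuclideanSpace ℝ (Fin 2))}
    (hwidth : HasConstantWidth K) : IsDolnikovNumber K 4 := by
  obtain ⟨w, hw⟩ := hwidth
  have hw0 : 0 ≤ w := by
    rw [← hw (EuclideanSpace.single 0 1) (by simp)]
    exact directionalWidth_nonneg K _
  obtain ⟨c, hc⟩ := exists_subset_closedBall_of_dist_le (s := K) (w := w) (R := 3 / 5 * w)
    (by positivity) (by nlinarith)
    fun x hx y hy => dist_le_of_directionalWidth_eq hw hw0 hx hy
  have hK : Metric.closedBall c (2 / 5 * w) ⊆ (K : Set (EuclideanSpace ℝ (Fin 2))) := by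
    convert closedBall_sub_subset_of_directionalWidth_eq hw hc using 2
    ring
  refine isDolnikovNumber_of_translatesPierced fun n _ V hfin hV => ?_
  have hdist : ∀ i j, i ≠ j → ∀ v ∈ V i, ∀ v' ∈ V j, dist v v' ≤ w := by
    intro i j hij v hv v' hv'
    obtain ⟨k, hk, l, hl, hkl⟩ := Set.mem_sub.1 (hV i j hij v hv v' hv')
    rw [dist_eq_norm, ← hkl, ← dist_eq_norm]
    exact dist_le_of_directionalWidth_eq hw hw0 hk hl
  have hfinU : ∀ j, (⋃ (i) (_ : i ≠ j), V i).Finite := fun j =>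
    Set.finite_iUnion fun i => Set.finite_iUnion fun _ => hfin i
  have hsub : ∀ j, (⋃ (i) (_ : i ≠ j), V i) ⊆ ⋃ i, V i := fun j =>
    Set.iUnion_mono fun i => Set.iUnion_subset fun _ => subset_rfl
  by_cases hall : ∀ a ∈ ⋃ i, V i, ∀ b ∈ ⋃ i, V i, dist a b ≤ w
  · exact ⟨0, translatesPierced_four_of_forall_dist_le hw0 hK (hfinU 0)
      fun a ha b hb => hall a (hsub 0 ha) b (hsub 0 hb)⟩
  push Not at hall
  obtain ⟨a, ha, b, hb, hab⟩ := hall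
  -- A farthest pair belongs to a single family, which is the one to be left out.
  have hfinW : (⋃ i, V i).Finite := Set.finite_iUnion hfin
  obtain ⟨⟨v, v'⟩, ⟨hv, hv'⟩, hmax⟩ := Set.exists_max_image _
    (fun p : EuclideanSpace ℝ (Fin 2) × EuclideanSpace ℝ (Fin 2) => dist p.1 p.2)
    (hfinW.prod hfinW) ⟨(a, b), ha, hb⟩
  have hvv : w < dist v v' := hab.trans_le (hmax (a, b) ⟨ha, hb⟩)
  obtain ⟨j, hj⟩ := Set.mem_iUnion.1 hv
  obtain ⟨j', hj'⟩ := Set.mem_iUnion.1 hv'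
  obtain rfl : j = j' := by
    by_contra hne
    exact hvv.not_ge (hdist j j' hne v hj v' hj')
  have hB : ∀ z ∈ V j, ∀ x ∈ ⋃ (i) (_ : i ≠ j), V i, dist x z ≤ w := fun z hz x hx => by
    simp only [Set.mem_iUnion] at hx
    obtain ⟨i, hij, hx⟩ := hx
    exact hdist i j hij x hx z hz
  exact ⟨j, translatesPierced_four_of_lens hw0 hK (hfinU j) hvv (hB v hj) (hB v' hj')
    fun x hx y hy => hmax (x, y) ⟨hsub j hx, hsub j hy⟩⟩

theorem mainTheorem3 :
    (∀ (d : ℕ) (K : ConvexBody (EuclideanSpace ℝ (Fin d))), ∃ m : ℕ, IsDolnikovNumber K m) ∧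
    (∀ K : ConvexBody (EuclideanSpace ℝ (Fin 2)), IsDolnikovNumber K 9) ∧
    (∀ K : ConvexBody (EuclideanSpace ℝ (Fin 2)), HasConstantWidth K → IsDolnikovNumber K 4) := by
  refine ⟨fun d K => ?_, isDolnikovNumber_nine, fun K => isDolnikovNumber_four⟩
  obtain ⟨m, hm⟩ := exists_translatesPierced_sub K.isCompact K.convex K.nonempty
  exact ⟨m, isDolnikovNumber_of_translatesPierced_sub hm⟩
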